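/- **Theorem 3.1 (Quantitative Helly with volume).** Let $d\ge 1$ be an integer and $\varepsilon>0$. A polytope in $\mathbb{R}^d$ is a bounded intersection of finitely many closed half-spaces, and its facets are its nonempty exposed faces of dimension one less than its own. Let $n=n^*(d,\varepsilon)$ be the smallest non-negative integer such that every convex set $K\subset\mathbb{R}^d$ of positive finite volume is contained in a polytope $P$ with at most $n$ facets and $\operatorname{vol}(P)\le(1+\varepsilon)\operatorname{vol}(K)$. Then such an integer exists, and the following hold. 1. If $\mathcal{F}$ is a finite family of convex sets in $\mathbb{R}^d$ such that $\operatorname{vol}\left(\bigcap\mathcal{F}'\right)\ge 1$ for every subfamily $\mathcal{F}'\subseteq\mathcal{F}$ of at most $nd$ sets, then $\operatorname{vol}\left(\bigcap\mathcal{F}\right)\ge(1+\varepsilon)^{-1}$. 2. Subfamilies of size $n-1$ do not suffice: there is a finite family $\mathcal{F}$ of convex sets in $\mathbb{R}^d$ such that $\operatorname{vol}\left(\bigcap\mathcal{F}'\right)\ge 1$ for every subfamily $\mathcal{F}'\subseteq\mathcal{F}$ of at most $n-1$ sets, but $\operatorname{vol}\left(\bigcap\mathcal{F}\right)<(1+\varepsilon)^{-1}$.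 Volumes may be infinite, and the intersection of the empty subfamily is $\mathbb{R}^d$. -/

import Mathlib

open MeasureTheory

/-- A closed half-space `{x | ⟪a, x⟫ ≤ b}` with `a ≠ 0`. -/
def IsClosedHalfSpace {E : Type*} [NormedAddCommGroup E] [InnerProductSpace ℝ E]
    (H : Set E) : Prop :=
  ∃ (a : E) (b : ℝ), a ≠ 0 ∧ H = {x | inner ℝ a x ≤ b}

/-- A polytope: a bounded intersection of finitely many closed half-spaces. -/
def IsPolytope {E : Type*} [NormedAddCommGroup E] [InnerProductSpace ℝ E]
    (P : Set E) : Prop :=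
  Bornology.IsBounded P ∧
    ∃ 𝓗 : Finset (Set E), (∀ H ∈ 𝓗, IsClosedHalfSpace H) ∧ P = ⋂ H ∈ 𝓗, H

/-- The facets of `P`: its nonempty exposed faces of dimension `dim P - 1`
(the dimension of a set being that of its affine hull). -/
def facets {E : Type*} [NormedAddCommGroup E] [InnerProductSpace ℝ E]
    (P : Set E) : Set (Set E) :=
  {F | IsExposed ℝ P F ∧ F.Nonempty ∧
    Module.finrank ℝ (vectorSpan ℝ F) + 1 = Module.finrank ℝ (vectorSpan ℝ P)}

/-- The numbers `n` such that every convex set `K` in `ℝ^d` of positive finite volume is contained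
in a polytope with at most `n` facets and volume at most `(1 + ε) vol K`. -/
def circumscribedFacetNumbers (d : ℕ) (ε : ℝ) : Set ℕ :=
  {n | ∀ K : Set (EuclideanSpace ℝ (Fin d)), Convex ℝ K → 0 < volume K → volume K < ⊤ →
    ∃ P : Set (EuclideanSpace ℝ (Fin d)), IsPolytope P ∧ K ⊆ P ∧
      (facets P).encard ≤ (n : ℕ∞) ∧ volume P ≤ ENNReal.ofReal (1 + ε) * volume K}

/-- `n^*(d, ε)`, the least element of `circumscribedFacetNumbers d ε`. -/
noncomputable def nStar (d : ℕ) (ε : ℝ) : ℕ :=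
  sInf (circumscribedFacetNumbers d ε)

/-! Facets and half-spaces are interchangeable here: an irredundant family of half-spaces with
full-dimensional intersection has exactly one facet per member. So `n^*` counts circumscribed
half-spaces (`mem_circumscribedFacetNumbers_iff`).

Existence of `n^*` is affine compactness. A simplex of maximal volume places every body, up to an
affine map, between two fixed balls. There the tangent half-spaces with normals in one fixed finite
net already cut out a subset of `(1 + δ) • K`.

For the Helly property, let `K` be the whole intersection, and enclose it in `n` half-spaces with
volume at most `(1 + ε) vol K`. The complement of each half-space is convex and misses `K`, so by
Helly's theorem some `d` members of the family already intersect inside that half-space. These at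
most `n * d` members together have intersection of volume at least 1 and contained in the polytope.

For the lower bound, a convex `K` defeats `m = n - 1` half-spaces. Volume is lower semicontinuous in
the normals of supporting half-spaces, so a minimum is attained and any `m` half-spaces containing
`K` meet in volume at least some `c > (1 + ε) vol K`. A much finer circumscribed polytope of `K`,
split into its half-spaces and rescaled, is the required family. -/

open scoped Pointwise

/-! ### Facets of an intersection of half-spaces versus the half-spaces themselves. -/

section Facets

variable {E : Type*} [NormedAddCommGroup E] [InnerProductSpace ℝ E]

/-- A nonzero functional does not attain its maximum over a set at an interior point. -/
theorem exists_mem_lt_of_mem_interior {P : Set E} {z : E} (hz : z ∈ interior P)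
    {l : E →L[ℝ] ℝ} (hl : l ≠ 0) : ∃ y ∈ P, l z < l y := by
  obtain ⟨v, hv⟩ : ∃ v, l v ≠ 0 := by
    by_contra! h
    exact hl (by ext v; simpa using h v)
  have hcont : Filter.Tendsto (fun t : ℝ => z + t • (l v • v)) (nhdsWithin 0 (Set.Ioi 0))
      (nhds z) := by
    have : Continuous (fun t : ℝ => z + t • (l v • v)) := by fun_prop
    simpa using (this.tendsto 0).mono_left nhdsWithin_le_nhds
  have hev := hcont.eventually (mem_interior_iff_mem_nhds.1 hz)
  obtain ⟨t, ht, ht0⟩ := (hev.and self_mem_nhdsWithin).exists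
  refine ⟨_, ht, ?_⟩
  have : 0 < t * (l v * l v) := mul_pos ht0 (mul_self_pos.2 hv)
  simpa using this

theorem inner_lt_of_mem_interior {P : Set E} {z : E} (hz : z ∈ interior P) {a : E} (ha : a ≠ 0)
    {b : ℝ} (hP : ∀ x ∈ P, inner ℝ a x ≤ b) : inner ℝ a z < b := by
  have hl : innerSL ℝ a ≠ 0 := by
    intro h
    have := congrArg (fun f : E →L[ℝ] ℝ => f a) h
    simp [ha] at this
  obtain ⟨y, hy, h⟩ := exists_mem_lt_of_mem_interior hz hl
  exact lt_of_lt_of_le h (hP y hy)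

theorem isOpen_setOf_forall_inner_lt {ι : Type*} (s : Finset ι) (a : ι → E) (b : ι → ℝ) :
    IsOpen {x : E | ∀ i ∈ s, inner ℝ (a i) x < b i} := by
  have : {x : E | ∀ i ∈ s, inner ℝ (a i) x < b i} =
      ⋂ i ∈ s, {x : E | inner ℝ (a i) x < b i} := by ext; simp
  rw [this]
  exact isOpen_biInter_finset fun i _ => isOpen_lt (by fun_prop) continuous_const

theorem vectorSpan_le_ker_of_forall_eq {F : Set E} (l : E →ₗ[ℝ] ℝ) {c : ℝ}
    (h : ∀ x ∈ F, l x = c) : vectorSpan ℝ F ≤ LinearMap.ker l := by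
  rw [vectorSpan_def, Submodule.span_le]
  rintro _ ⟨x, hx, y, hy, rfl⟩
  simp [h x hx, h y hy]

theorem IsClosedHalfSpace.isClosed {H : Set E} (hH : IsClosedHalfSpace H) : IsClosed H := by
  obtain ⟨a, b, -, rfl⟩ := hH
  exact isClosed_le (by fun_prop) continuous_const

theorem IsClosedHalfSpace.convex {H : Set E} (hH : IsClosedHalfSpace H) : Convex ℝ H := by
  obtain ⟨a, b, -, rfl⟩ := hH
  exact convex_halfSpace_le (innerSL ℝ a).isLinear b

theorem IsClosedHalfSpace.convex_compl {H : Set E} (hH : IsClosedHalfSpace H) :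
    Convex ℝ Hᶜ := by
  obtain ⟨a, b, -, rfl⟩ := hH
  have : {x : E | inner ℝ a x ≤ b}ᶜ = {x | b < innerSL ℝ a x} := by ext; simp
  rw [this]
  exact convex_halfSpace_gt (innerSL ℝ a).isLinear b

theorem convex_biInter_halfSpaces {𝓗 : Finset (Set E)} (h𝓗 : ∀ H ∈ 𝓗, IsClosedHalfSpace H) :
    Convex ℝ (⋂ H ∈ 𝓗, H) :=
  convex_iInter₂ fun H hH => (h𝓗 H hH).convex

theorem vectorSpan_eq_top_of_nonempty_interior {P : Set E} (hP : (interior P).Nonempty) :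
    vectorSpan ℝ P = ⊤ := by
  have h : affineSpan ℝ P = ⊤ :=
    affineSpan_eq_top_of_nonempty_interior (hP.mono (interior_mono (subset_convexHull ℝ P)))
  rw [← direction_affineSpan, h, AffineSubspace.direction_top]

variable [FiniteDimensional ℝ E]

/-- Each facet of a full-dimensional intersection of half-spaces is cut out by the bounding
hyperplane of one of them. -/
theorem exists_eq_inter_of_mem_facets {𝓗 : Finset (Set E)} {a : Set E → E} {b : Set E → ℝ}
    {P : Set E} (ha : ∀ H ∈ 𝓗, a H ≠ 0)
    (hP : ∀ x, x ∈ P ↔ ∀ H ∈ 𝓗, inner ℝ (a H) x ≤ b H) (hint : (interior P).Nonempty)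
    {F : Set E} (hF : F ∈ facets P) :
    ∃ H ∈ 𝓗, F = {x ∈ P | inner ℝ (a H) x = b H} := by
  classical
  obtain ⟨hexp, hne, hdim⟩ := hF
  obtain ⟨l, hl⟩ := hexp hne
  have htop := vectorSpan_eq_top_of_nonempty_interior hint
  rw [htop, finrank_top] at hdim
  have hconv : Convex ℝ P := by
    have : P = ⋂ H ∈ 𝓗, {x | inner ℝ (a H) x ≤ b H} := by ext; simp [hP]
    rw [this]
    exact convex_iInter₂ fun H _ => convex_halfSpace_le (innerSL ℝ (a H)).isLinear (b H)
  have hFconv : Convex ℝ F := hexp.convex hconv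
  have hFP : F ⊆ P := hexp.subset
  have hl0 : l ≠ 0 := by
    rintro rfl
    have : F = P := by simp [hl]
    rw [this, htop, finrank_top] at hdim
    omega
  -- Otherwise averaging points of `F`, one off each bounding hyperplane, gives a point of `F`
  -- interior to `P`, where the exposing functional cannot be maximal.
  obtain ⟨H, hH, hFH⟩ : ∃ H ∈ 𝓗, ∀ x ∈ F, inner ℝ (a H) x = b H := by
    by_contra! h
    have key : ∀ s : Finset (Set E), s ⊆ 𝓗 → ∃ z ∈ F, ∀ H ∈ s, inner ℝ (a H) z < b H := by
      intro s
      induction s using Finset.induction_on with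
      | empty => exact fun _ => ⟨hne.some, hne.some_mem, by simp⟩
      | insert G s hG ih =>
        intro hs
        obtain ⟨z, hz, hzs⟩ := ih ((Finset.subset_insert _ _).trans hs)
        obtain ⟨x, hx, hxG⟩ := h G (hs (Finset.mem_insert_self _ _))
        have hle : ∀ y ∈ F, ∀ H ∈ insert G s, inner ℝ (a H) y ≤ b H :=
          fun y hy H hH => (hP y).1 (hFP hy) H (hs hH)
        refine ⟨(1/2 : ℝ) • z + (1/2 : ℝ) • x,
          hFconv hz hx (by norm_num) (by norm_num) (by norm_num), fun H hH => ?_⟩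
        rw [inner_add_right, inner_smul_right, inner_smul_right]
        have h1 := hle z hz H hH
        have h2 := hle x hx H hH
        rcases Finset.mem_insert.1 hH with rfl | hH'
        · have := lt_of_le_of_ne h2 hxG
          linarith
        · have := hzs H hH'
          linarith
    obtain ⟨z, hz, hzs⟩ := key 𝓗 subset_rfl
    have hzi : z ∈ interior P := by
      refine mem_interior.2 ⟨_, fun x hx => ?_, isOpen_setOf_forall_inner_lt 𝓗 a b, hzs⟩
      exact (hP x).2 fun H hH => (hx H hH).le
    obtain ⟨y, hy, hlt⟩ := exists_mem_lt_of_mem_interior hzi hl0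
    rw [hl] at hz
    exact absurd (hz.2 y hy) (not_le.2 hlt)
  refine ⟨H, hH, Set.Subset.antisymm (fun x hx => ⟨hFP hx, hFH x hx⟩) ?_⟩
  rintro x ⟨hxP, hxH⟩
  obtain ⟨x₀, hx₀⟩ := hne
  set f : E →ₗ[ℝ] ℝ := (innerSL ℝ (a H)).toLinearMap with hf
  have hf0 : f ≠ 0 := by
    intro h
    have := congrArg (fun g : E →ₗ[ℝ] ℝ => g (a H)) h
    simp [hf, ha H hH] at this
  have hl0' : (l : E →ₗ[ℝ] ℝ) ≠ 0 := fun h => hl0 (by ext v; exact congrArg (fun g => g v) h)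
  have hkf := Module.Dual.finrank_ker_add_one_of_ne_zero (f := f) hf0
  have hkl := Module.Dual.finrank_ker_add_one_of_ne_zero (f := (l : E →ₗ[ℝ] ℝ)) hl0'
  have h1 : vectorSpan ℝ F ≤ LinearMap.ker f := vectorSpan_le_ker_of_forall_eq f hFH
  have h2 : vectorSpan ℝ F ≤ LinearMap.ker (l : E →ₗ[ℝ] ℝ) := by
    refine vectorSpan_le_ker_of_forall_eq (c := l x₀) _ fun y hy => ?_
    rw [hl] at hy hx₀
    exact le_antisymm (hx₀.2 y hy.1) (hy.2 x₀ hx₀.1)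
  -- The direction of `F` has codimension one, so it fills both kernels. Hence `l` is constant on
  -- the hyperplane of `H`, and all of `P` on that hyperplane is exposed.
  have e1 := Submodule.eq_of_le_of_finrank_eq h1 (by omega)
  have e2 := Submodule.eq_of_le_of_finrank_eq h2 (by omega)
  have hmem : x - x₀ ∈ LinearMap.ker f := by
    simp only [hf, LinearMap.mem_ker, ContinuousLinearMap.coe_coe, innerSL_apply_apply,
      inner_sub_right]
    rw [hxH, hFH x₀ hx₀, sub_self]
  rw [← e1, e2] at hmem
  have hlx : l x = l x₀ := by simpa [sub_eq_zero] using hmem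
  rw [hl] at hx₀ ⊢
  exact ⟨hxP, fun y hy => hlx ▸ hx₀.2 y hy⟩

/-- A full-dimensional intersection of `m` half-spaces has at most `m` facets. -/
theorem encard_facets_le {𝓗 : Finset (Set E)} (h𝓗 : ∀ H ∈ 𝓗, IsClosedHalfSpace H)
    (hint : (interior (⋂ H ∈ 𝓗, H)).Nonempty) :
    (facets (⋂ H ∈ 𝓗, H)).encard ≤ 𝓗.card := by
  classical
  choose! a b ha hH using h𝓗
  set P := ⋂ H ∈ 𝓗, H with hPdef
  have hP : ∀ x, x ∈ P ↔ ∀ H ∈ 𝓗, inner ℝ (a H) x ≤ b H := by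
    intro x
    simp only [hPdef, Set.mem_iInter]
    refine forall₂_congr fun H h => ?_
    conv_lhs => rw [hH H h]
    rfl
  have hsub : facets P ⊆ (fun H => {x ∈ P | inner ℝ (a H) x = b H}) '' (𝓗 : Set (Set E)) := by
    intro F hF
    obtain ⟨H, h, rfl⟩ := exists_eq_inter_of_mem_facets ha hP hint hF
    exact ⟨H, h, rfl⟩
  calc (facets P).encard ≤ _ := Set.encard_le_encard hsub
    _ ≤ (𝓗 : Set (Set E)).encard := Set.encard_image_le _ _
    _ = 𝓗.card := Set.encard_coe_eq_coe_finsetCard 𝓗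

/-- A full-dimensional intersection of finitely many half-spaces is already the intersection of at
most as many of them as it has facets. -/
theorem exists_subset_card_le_encard_facets {𝓗 : Finset (Set E)}
    (h𝓗 : ∀ H ∈ 𝓗, IsClosedHalfSpace H) (hint : (interior (⋂ H ∈ 𝓗, H)).Nonempty) :
    ∃ 𝓖 ⊆ 𝓗, ⋂ H ∈ 𝓖, H = ⋂ H ∈ 𝓗, H ∧ (𝓖.card : ℕ∞) ≤ (facets (⋂ H ∈ 𝓗, H)).encard := by
  classical
  choose! a b ha hH using h𝓗
  set P := ⋂ H ∈ 𝓗, H with hPdef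
  -- Minimal cardinality makes `𝓖` irredundant, so each member cuts out a facet of its own.
  obtain ⟨𝓖, h𝓖, hmin⟩ := Finset.exists_min_image
    (𝓗.powerset.filter fun s => ⋂ H ∈ s, H = P) Finset.card ⟨𝓗, by simp [hPdef]⟩
  simp only [Finset.mem_filter, Finset.mem_powerset] at h𝓖 hmin
  obtain ⟨hsub, h𝓖P⟩ := h𝓖
  refine ⟨𝓖, hsub, h𝓖P, ?_⟩
  have hmem : ∀ H ∈ 𝓖, ∀ x, x ∈ H ↔ inner ℝ (a H) x ≤ b H := by
    intro H h x
    conv_lhs => rw [hH H (hsub h)]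
    rfl
  have hP : ∀ x, x ∈ P ↔ ∀ H ∈ 𝓖, inner ℝ (a H) x ≤ b H := by
    intro x
    rw [← h𝓖P]
    simp only [Set.mem_iInter]
    exact forall₂_congr fun H h => hmem H h x
  obtain ⟨z, hz⟩ := hint
  have hzlt : ∀ H ∈ 𝓖, inner ℝ (a H) z < b H := fun H h =>
    inner_lt_of_mem_interior hz (ha H (hsub h)) fun x hx => (hP x).1 hx H h
  -- a point on the bounding hyperplane of `H`, in the interior of the other half-spaces
  have hw : ∀ H ∈ 𝓖, ∃ w, inner ℝ (a H) w = b H ∧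
      ∀ G ∈ 𝓖.erase H, inner ℝ (a G) w < b G := by
    intro H h
    obtain ⟨y, hyG, hyH⟩ : ∃ y, (∀ G ∈ 𝓖.erase H, inner ℝ (a G) y ≤ b G) ∧
        b H < inner ℝ (a H) y := by
      by_contra! hc
      have hlt := Finset.card_erase_lt_of_mem h
      refine absurd (hmin (𝓖.erase H) ⟨(Finset.erase_subset _ _).trans hsub, ?_⟩) (not_le.2 hlt)
      ext x
      rw [hP]
      simp only [Set.mem_iInter]
      constructor
      · intro hx G hG
        have hx' : ∀ G ∈ 𝓖.erase H, inner ℝ (a G) x ≤ b G := fun G hG =>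
          (hmem G (Finset.mem_of_mem_erase hG) x).1 (hx G hG)
        by_cases hGH : G = H
        · subst hGH
          exact hc x hx'
        · exact hx' G (Finset.mem_erase.2 ⟨hGH, hG⟩)
      · intro hx G hG
        exact (hmem G (Finset.mem_of_mem_erase hG) x).2 (hx G (Finset.mem_of_mem_erase hG))
    have hzH := hzlt H h
    -- The parameter at which the segment from the interior point `z` to `y` crosses the bounding
    -- hyperplane of `H`.
    set t : ℝ := (b H - inner ℝ (a H) z) / (inner ℝ (a H) y - inner ℝ (a H) z) with ht
    have hden : 0 < inner ℝ (a H) y - inner ℝ (a H) z := by linarith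
    have ht0 : 0 < t := div_pos (by linarith) hden
    have ht1 : t < 1 := (div_lt_one hden).2 (by linarith)
    have htm : t * (inner ℝ (a H) y - inner ℝ (a H) z) = b H - inner ℝ (a H) z :=
      div_mul_cancel₀ _ hden.ne'
    refine ⟨(1 - t) • z + t • y, ?_, fun G hG => ?_⟩
    · rw [inner_add_right, inner_smul_right, inner_smul_right]
      linarith
    · rw [inner_add_right, inner_smul_right, inner_smul_right]
      have h1 := hzlt G (Finset.mem_of_mem_erase hG)
      have h2 := hyG G hG
      nlinarith
  choose! w hwH hwG using hw
  have hwP : ∀ H ∈ 𝓖, w H ∈ P := by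
    intro H h
    refine (hP _).2 fun G hG => ?_
    by_cases hGH : G = H
    · subst hGH
      exact (hwH G h).le
    · exact (hwG H h G (Finset.mem_erase.2 ⟨hGH, hG⟩)).le
  let φ : Set E → Set E := fun H => {x ∈ P | inner ℝ (a H) x = b H}
  have hinj : Set.InjOn φ 𝓖 := by
    intro H h G hG heq
    by_contra hne
    have h1 : w H ∈ φ H := ⟨hwP H h, hwH H h⟩
    rw [heq] at h1
    exact absurd h1.2 (hwG H h G (Finset.mem_erase.2 ⟨Ne.symm hne, hG⟩)).ne
  have hmaps : φ '' (𝓖 : Set (Set E)) ⊆ facets P := by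
    rintro _ ⟨H, h, rfl⟩
    have h : H ∈ 𝓖 := h
    refine ⟨fun _ => ⟨innerSL ℝ (a H), ?_⟩, ⟨w H, hwP H h, hwH H h⟩, ?_⟩
    · ext x
      simp only [φ, Set.mem_ofPred_eq, innerSL_apply_apply]
      refine and_congr_right fun hx => ⟨fun he y hy => he ▸ (hP y).1 hy H h, fun hy => ?_⟩
      exact le_antisymm ((hP x).1 hx H h) (hwH H h ▸ hy _ (hwP H h))
    · rw [vectorSpan_eq_top_of_nonempty_interior ⟨z, hz⟩, finrank_top]
      set f : E →ₗ[ℝ] ℝ := (innerSL ℝ (a H)).toLinearMap with hf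
      have hf0 : f ≠ 0 := by
        intro h0
        have := congrArg (fun g : E →ₗ[ℝ] ℝ => g (a H)) h0
        simp [hf, ha H (hsub h)] at this
      rw [← Module.Dual.finrank_ker_add_one_of_ne_zero (f := f) hf0]
      suffices vectorSpan ℝ (φ H) = LinearMap.ker f by rw [this]
      -- The other constraints are strict at `w H`, so a small move along the hyperplane stays in
      -- the face.
      refine le_antisymm (vectorSpan_le_ker_of_forall_eq f fun x hx => hx.2) fun v hv => ?_
      have hv' : inner ℝ (a H) v = 0 := by simpa [hf] using hv
      have hopen := isOpen_setOf_forall_inner_lt (𝓖.erase H) a b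
      have hcont : Filter.Tendsto (fun t : ℝ => w H + t • v) (nhdsWithin 0 (Set.Ioi 0))
          (nhds (w H)) := by
        have : Continuous (fun t : ℝ => w H + t • v) := by fun_prop
        simpa using (this.tendsto 0).mono_left nhdsWithin_le_nhds
      obtain ⟨t, ht, ht0⟩ := ((hcont.eventually (hopen.mem_nhds (hwG H h))).and
        self_mem_nhdsWithin).exists
      have hon : inner ℝ (a H) (w H + t • v) = b H := by
        rw [inner_add_right, inner_smul_right, hv', hwH H h]; simp
      have hmemφ : w H + t • v ∈ φ H := by
        refine ⟨(hP _).2 fun G hG => ?_, hon⟩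
        by_cases hGH : G = H
        · subst hGH
          exact hon.le
        · exact (ht G (Finset.mem_erase.2 ⟨hGH, hG⟩)).le
      have hd := vsub_mem_vectorSpan ℝ hmemφ (⟨hwP H h, hwH H h⟩ : w H ∈ φ H)
      have ht0' : (t : ℝ) ≠ 0 := ne_of_gt ht0
      have := (vectorSpan ℝ (φ H)).smul_mem t⁻¹ hd
      simpa [smul_smul, ht0'] using this
  calc (𝓖.card : ℕ∞) = (𝓖 : Set (Set E)).encard := (Set.encard_coe_eq_coe_finsetCard 𝓖).symm
    _ = (φ '' (𝓖 : Set (Set E))).encard := hinj.encard_image.symm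
    _ ≤ _ := Set.encard_le_encard hmaps

end Facets

/-! ### Convex sets and Haar measure. -/

section ConvexVolume

variable {E : Type*} [NormedAddCommGroup E] [NormedSpace ℝ E]
  [MeasurableSpace E] [BorelSpace E] (μ : Measure E) [μ.IsAddHaarMeasure]

/-- A convex set with interior points and finite measure is bounded. -/
theorem Convex.isBounded_of_measure_lt_top {K : Set E} (hK : Convex ℝ K)
    (hint : (interior K).Nonempty) (hfin : μ K < ⊤) : Bornology.IsBounded K := by
  by_contra hunb
  obtain ⟨x, hx⟩ := hint
  obtain ⟨r, hr, hball⟩ := Metric.mem_nhds_iff.1 (mem_interior_iff_mem_nhds.1 hx)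
  -- This is the image of the ball about `x` under the homothety with centre `y` and ratio 1/2.
  have hmid : ∀ y ∈ K, Metric.ball ((1/2 : ℝ) • x + (1/2 : ℝ) • y) (r/2) ⊆ K := by
    intro y hy z hz
    have h1 : (2 : ℝ) • z - y ∈ K := by
      refine hball ?_
      rw [Metric.mem_ball, dist_eq_norm] at hz ⊢
      have : (2 : ℝ) • z - y - x = (2 : ℝ) • (z - ((1/2 : ℝ) • x + (1/2 : ℝ) • y)) := by
        simp only [smul_sub, smul_add, smul_smul]
        norm_num
        abel
      rw [this, norm_smul]
      norm_num
      linarith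
    have := hK h1 hy (show (0:ℝ) ≤ 1/2 by norm_num) (show (0:ℝ) ≤ 1/2 by norm_num) (by norm_num)
    convert this using 1
    rw [smul_sub, smul_smul]
    norm_num
  -- An unbounded set contains an infinite `2 * r`-separated sequence. The corresponding midpoint
  -- balls of radius `r / 2` are disjoint and of equal positive measure.
  have : Std.Symm fun y z : E => 2 * r ≤ dist y z := ⟨fun y z h => by rwa [dist_comm]⟩
  obtain ⟨f, hf, hfd⟩ := exists_seq_of_forall_finset_exists' (fun y : E => y ∈ K)
    (fun y z => 2 * r ≤ dist y z) (by
      intro s _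
      by_contra! hcon
      refine hunb ?_
      have : K ⊆ ⋃ y ∈ s, Metric.ball y (2 * r) := by
        intro z hz
        obtain ⟨y, hy, hlt⟩ := hcon z hz
        simp only [Set.mem_iUnion]
        exact ⟨y, hy, by rwa [Metric.mem_ball, dist_comm]⟩
      refine Bornology.IsBounded.subset ?_ this
      exact (Bornology.isBounded_biUnion_finset s).2 fun _ _ => Metric.isBounded_ball)
  let g : ℕ → Set E := fun n => Metric.ball ((1/2 : ℝ) • x + (1/2 : ℝ) • f n) (r/2)
  have hdisj : Pairwise (Function.onFun Disjoint g) := by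
    intro m n hmn
    refine Metric.ball_disjoint_ball ?_
    have h2 := hfd hmn
    simp only [Function.onFun] at h2
    rw [dist_add_left, dist_smul₀]
    norm_num
    linarith
  have hsum : μ (⋃ n, g n) = ∑' n, μ (g n) :=
    measure_iUnion hdisj fun n => measurableSet_ball
  have hconst : ∀ n, μ (g n) = μ (Metric.ball (0 : E) (r/2)) := fun n =>
    Measure.addHaar_ball_center μ _ _
  have hpos : 0 < μ (Metric.ball (0 : E) (r/2)) := Metric.measure_ball_pos μ 0 (by linarith)
  rw [tsum_congr hconst, ENNReal.tsum_const_eq_top_of_ne_zero hpos.ne'] at hsum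
  have hsub : ⋃ n, g n ⊆ K := Set.iUnion_subset fun n => hmid _ (hf n)
  exact absurd (measure_mono hsub) (not_le.2 (hsum ▸ hfin))

variable [FiniteDimensional ℝ E]

/-- With empty interior the set would lie in its own frontier, which is null for a convex set. -/
theorem Convex.nonempty_interior_of_measure_pos {K : Set E} (hK : Convex ℝ K) (h : 0 < μ K) :
    (interior K).Nonempty := by
  by_contra hne
  rw [Set.not_nonempty_iff_eq_empty] at hne
  refine h.ne' (measure_mono_null ?_ (hK.addHaar_frontier μ))
  rw [frontier, hne, Set.sdiff_empty]
  exact subset_closure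

theorem Convex.measure_closure {K : Set E} (hK : Convex ℝ K) : μ (closure K) = μ K := by
  refine le_antisymm ?_ (measure_mono subset_closure)
  calc μ (closure K) ≤ μ (K ∪ frontier K) := measure_mono (closure_eq_self_union_frontier K).le
    _ ≤ μ K + μ (frontier K) := measure_union_le _ _
    _ = μ K := by rw [hK.addHaar_frontier μ, add_zero]

end ConvexVolume

/-- Facet counts may be replaced by counts of bounding half-spaces in the definition of
`circumscribedFacetNumbers`. -/
theorem mem_circumscribedFacetNumbers_iff {d n : ℕ} {ε : ℝ} :
    n ∈ circumscribedFacetNumbers d ε ↔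
      ∀ K : Set (EuclideanSpace ℝ (Fin d)), Convex ℝ K → 0 < volume K → volume K < ⊤ →
        ∃ 𝓗 : Finset (Set (EuclideanSpace ℝ (Fin d))), (∀ H ∈ 𝓗, IsClosedHalfSpace H) ∧
          𝓗.card ≤ n ∧ K ⊆ ⋂ H ∈ 𝓗, H ∧
          volume (⋂ H ∈ 𝓗, H) ≤ ENNReal.ofReal (1 + ε) * volume K := by
  refine forall₄_congr fun K hK hpos hfin => ?_
  have hint : ∀ P, K ⊆ P → (interior P).Nonempty := fun P hKP =>
    (hK.nonempty_interior_of_measure_pos volume hpos).mono (interior_mono hKP)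
  constructor
  · rintro ⟨P, ⟨-, 𝓗, h𝓗, rfl⟩, hKP, hcard, hvol⟩
    obtain ⟨𝓖, hsub, heq, h𝓖⟩ := exists_subset_card_le_encard_facets h𝓗 (hint _ hKP)
    exact ⟨𝓖, fun H hH => h𝓗 H (hsub hH), by exact_mod_cast h𝓖.trans hcard, heq ▸ hKP,
      heq ▸ hvol⟩
  · rintro ⟨𝓗, h𝓗, hcard, hKP, hvol⟩
    refine ⟨⋂ H ∈ 𝓗, H, ⟨?_, 𝓗, h𝓗, rfl⟩, hKP,
      (encard_facets_le h𝓗 (hint _ hKP)).trans (by exact_mod_cast hcard), hvol⟩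
    -- Boundedness comes for free from finite volume.
    exact (convex_biInter_halfSpaces h𝓗).isBounded_of_measure_lt_top volume (hint _ hKP)
      (hvol.trans_lt (ENNReal.mul_lt_top ENNReal.ofReal_lt_top hfin))

/-! ### Uniform approximation by tangent half-spaces with normals in a finite net. -/

section Net

variable {E : Type*} [NormedAddCommGroup E] [InnerProductSpace ℝ E] [FiniteDimensional ℝ E]

/-- A point outside a closed convex set is separated from it by a unit normal vector. -/
theorem exists_unit_normal_separating {K : Set E} (hK : Convex ℝ K) (hcl : IsClosed K)
    (hne : K.Nonempty) {x : E} (hx : x ∉ K) :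
    ∃ u : E, ‖u‖ = 1 ∧ ∃ s : ℝ, (∀ y ∈ K, inner ℝ u y < s) ∧ s < inner ℝ u x := by
  obtain ⟨f, s, hf, hs⟩ := geometric_hahn_banach_closed_point hK hcl hx
  set a := (InnerProductSpace.toDual ℝ E).symm f with ha
  have hfa : ∀ y, f y = inner ℝ a y := fun y => by simp [ha]
  have ha0 : a ≠ 0 := by
    intro h0
    obtain ⟨y, hy⟩ := hne
    have h1 := (hf y hy).trans hs
    rw [hfa, hfa, h0] at h1
    simp at h1
  have hpos : 0 < ‖a‖⁻¹ := inv_pos.2 (norm_pos_iff.2 ha0)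
  refine ⟨‖a‖⁻¹ • a, norm_smul_inv_norm ha0, ‖a‖⁻¹ * s, fun y hy => ?_, ?_⟩
  · rw [real_inner_smul_left, ← hfa]
    exact mul_lt_mul_of_pos_left (hf y hy) hpos
  · rw [real_inner_smul_left, ← hfa]
    exact mul_lt_mul_of_pos_left hs hpos

variable [MeasurableSpace E] [BorelSpace E] (μ : Measure E) [μ.IsAddHaarMeasure]

/-- Convex bodies lying between two fixed balls are uniformly approximated by circumscribed
intersections of half-spaces. -/
theorem exists_card_circumscribed_of_ball_subset {r R ε : ℝ} (hr : 0 < r) (hR : 0 < R)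
    (hε : 0 < ε) :
    ∃ n : ℕ, ∀ K : Set E, Convex ℝ K → IsCompact K → Metric.ball 0 r ⊆ K →
      K ⊆ Metric.closedBall 0 R →
      ∃ 𝓗 : Finset (Set E), (∀ H ∈ 𝓗, IsClosedHalfSpace H) ∧ 𝓗.card ≤ n ∧
        K ⊆ ⋂ H ∈ 𝓗, H ∧ μ (⋂ H ∈ 𝓗, H) ≤ ENNReal.ofReal (1 + ε) * μ K := by
  classical
  obtain ⟨δ, hδ0, hδ1, hδ⟩ : ∃ δ : ℝ, 0 < δ ∧ δ < 1 ∧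
      (1 + δ) ^ Module.finrank ℝ E ≤ 1 + ε := by
    have hcont : Filter.Tendsto (fun t : ℝ => (1 + t) ^ Module.finrank ℝ E)
        (nhdsWithin 0 (Set.Ioi 0)) (nhds 1) := by
      have : Continuous (fun t : ℝ => (1 + t) ^ Module.finrank ℝ E) := by fun_prop
      simpa using (this.tendsto 0).mono_left nhdsWithin_le_nhds
    have h1 := hcont.eventually (Iio_mem_nhds (show (1:ℝ) < 1 + ε by linarith))
    have h2 : ∀ᶠ t : ℝ in nhdsWithin 0 (Set.Ioi 0), t < 1 :=
      nhdsWithin_le_nhds (Iio_mem_nhds one_pos)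
    obtain ⟨t, ⟨h1, h2⟩, h3⟩ := ((h1.and h2).and self_mem_nhdsWithin).exists
    exact ⟨t, h3, h2, le_of_lt h1⟩
  -- Replacing `u` by a net vector costs at most `2 * η * R` at `x'` and `η * R` at `y v`, in total
  -- `δ * r / 2`.
  set η : ℝ := δ * r / (6 * R) with hη
  have hη0 : 0 < η := by positivity
  obtain ⟨N, hNs, hNfin, hN⟩ := finite_cover_balls_of_compact (isCompact_sphere (0 : E) 1) hη0
  refine ⟨hNfin.toFinset.card, fun K hK hKc hball hKR => ?_⟩
  have h0K : (0 : E) ∈ K := hball (by simpa using hr)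
  have hmax : ∀ v : E, ∃ y ∈ K, ∀ z ∈ K, inner ℝ v z ≤ inner ℝ v y := fun v =>
    hKc.exists_isMaxOn ⟨0, h0K⟩ (f := fun z => inner ℝ v z) (by fun_prop)
  choose y hyK hymax using hmax
  have hnormK : ∀ z ∈ K, ‖z‖ ≤ R := fun z hz => by simpa using hKR hz
  let g : E → Set E := fun v => {x | inner ℝ v x ≤ inner ℝ v (y v)}
  set P := ⋂ H ∈ hNfin.toFinset.image g, H with hPdef
  have hhs : ∀ H ∈ hNfin.toFinset.image g, IsClosedHalfSpace H := by
    intro H hH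
    obtain ⟨v, hv, rfl⟩ := Finset.mem_image.1 hH
    refine ⟨v, _, ?_, rfl⟩
    have : ‖v‖ = 1 := by simpa using hNs ((Set.Finite.mem_toFinset _).1 hv)
    exact norm_pos_iff.1 (by rw [this]; exact one_pos)
  have hKP : K ⊆ P := by
    intro z hz
    simp only [hPdef, Set.mem_iInter, Finset.mem_image]
    rintro _ ⟨v, -, rfl⟩
    exact hymax v z hz
  refine ⟨_, hhs, Finset.card_image_le, hKP, ?_⟩
  have hPsub : P ⊆ (1 + δ) • K := by
    intro x hxP
    by_contra hx
    -- reduce to a point of norm at most `2 * R`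
    obtain ⟨x', hx'P, hx'K, hx'R⟩ : ∃ x' ∈ P, x' ∉ (1 + δ) • K ∧ ‖x'‖ ≤ 2 * R := by
      by_cases hxR : ‖x‖ ≤ 2 * R
      · exact ⟨x, hxP, hx, hxR⟩
      push Not at hxR
      have hx0 : 0 < ‖x‖ := by linarith
      have hn : ‖(2 * R / ‖x‖) • x‖ = 2 * R := by
        rw [norm_smul, norm_div, norm_norm, div_mul_cancel₀ _ hx0.ne', Real.norm_of_nonneg]
        positivity
      refine ⟨(2 * R / ‖x‖) • x, ?_, ?_, hn.le⟩
      · exact (convex_biInter_halfSpaces hhs).smul_mem_of_zero_mem (hKP h0K) hxP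
          ⟨by positivity, (div_le_one hx0).2 hxR.le⟩
      -- Points of `(1 + δ) • K` have norm at most `(1 + δ) * R`, which is below `2 * R` because `δ
      -- < 1`.
      · rintro ⟨k, hk, hkx⟩
        have h1 := hnormK k hk
        have h2 : ‖(1 + δ) • k‖ = 2 * R := by rw [← hn, ← hkx]
        rw [norm_smul, Real.norm_of_nonneg (by linarith)] at h2
        nlinarith
    obtain ⟨u, hu, s, hsK, hsx⟩ := exists_unit_normal_separating (hK.smul (1 + δ))
      (hKc.smul (1 + δ)).isClosed ⟨_, Set.smul_mem_smul_set h0K⟩ hx'K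
    have hsK' : ∀ z ∈ K, (1 + δ) * inner ℝ u z < s := fun z hz => by
      have := hsK _ (Set.smul_mem_smul_set (a := 1 + δ) hz)
      rwa [real_inner_smul_right] at this
    obtain ⟨v, hvN, huv⟩ : ∃ v ∈ N, u ∈ Metric.ball v η := by
      simpa using hN (show u ∈ Metric.sphere (0 : E) 1 by simpa using hu)
    have huv' : ‖u - v‖ ≤ η := by
      rw [← dist_eq_norm]
      exact (Metric.mem_ball.1 huv).le
    have hx'v : inner ℝ v x' ≤ inner ℝ v (y v) := by
      have : ∀ H ∈ hNfin.toFinset.image g, x' ∈ H := by simpa [hPdef] using hx'P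
      exact this _ (Finset.mem_image_of_mem g (by simpa using hvN))
    have h1 : inner ℝ (u - v) x' ≤ η * (2 * R) :=
      (real_inner_le_norm _ _).trans (mul_le_mul huv' hx'R (norm_nonneg _) hη0.le)
    have h2 : -inner ℝ (u - v) (y v) ≤ η * R := by
      rw [← inner_neg_right]
      refine (real_inner_le_norm _ _).trans ?_
      rw [norm_neg]
      exact mul_le_mul huv' (hnormK _ (hyK v)) (norm_nonneg _) hη0.le
    rw [inner_sub_left] at h1 h2
    have h3 := hsK' _ (hyK v)
    have h4 := hsK' ((r / 2) • u) (hball (by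
      rw [mem_ball_zero_iff, norm_smul, hu, Real.norm_of_nonneg (by linarith)]; linarith))
    rw [real_inner_smul_right, real_inner_self_eq_norm_sq, hu] at h4
    have h5 : η * R * 6 = δ * r := by rw [hη]; field_simp
    -- Put `q = ⟪u, y v⟫`; the net estimate gives `s < q + δ * r / 2`. Then `h3` forces `q < r / 2`,
    -- while `h4` forces `q > r / 2`.
    nlinarith
  calc μ P ≤ μ ((1 + δ) • K) := measure_mono hPsub
    _ = ENNReal.ofReal ((1 + δ) ^ Module.finrank ℝ E) * μ K :=
      Measure.addHaar_smul_of_nonneg μ (by linarith) K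
    _ ≤ _ := by gcongr

end Net

/-! ### Affine normalization by a simplex of maximal volume, and existence of `n^*`. -/

section Normalization

/-- Every convex body has an affine image lying between two balls that depend only on the
dimension. -/
theorem exists_affine_normalization (d : ℕ) :
    ∃ r > 0, ∃ R > 0, ∀ K : Set (EuclideanSpace ℝ (Fin d)), Convex ℝ K → IsCompact K →
      (interior K).Nonempty →
      ∃ (T : EuclideanSpace ℝ (Fin d) ≃L[ℝ] EuclideanSpace ℝ (Fin d))
        (w : EuclideanSpace ℝ (Fin d)),
        Metric.ball 0 r ⊆ (fun x => T x + w) '' K ∧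
        (fun x => T x + w) '' K ⊆ Metric.closedBall 0 R := by
  classical
  let U : Set (EuclideanSpace ℝ (Fin d)) := {x | (∀ i, 0 < x i) ∧ ∑ i, x i < 1}
  let c : EuclideanSpace ℝ (Fin d) := WithLp.toLp 2 fun _ => 1 / ((d : ℝ) + 1)
  have hU : IsOpen U := by
    have hsum : IsOpen {x : EuclideanSpace ℝ (Fin d) | ∑ i, x i < 1} :=
      isOpen_lt (by fun_prop) continuous_const
    refine IsOpen.inter ?_ hsum
    have : {x : EuclideanSpace ℝ (Fin d) | ∀ i, 0 < x i} = ⋂ i, {x : EuclideanSpace ℝ (Fin d) | 0 < x i} := by ext; simp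
    change IsOpen {x : EuclideanSpace ℝ (Fin d) | ∀ i, 0 < x i}
    rw [this]
    exact isOpen_iInter_of_finite fun i => isOpen_lt continuous_const (by fun_prop)
  have hcU : c ∈ U := by
    refine ⟨fun i => by simp only [c]; positivity, ?_⟩
    simp only [c, Finset.sum_const, Finset.card_univ, Fintype.card_fin, nsmul_eq_mul]
    rw [mul_one_div, div_lt_one (by positivity)]
    linarith
  obtain ⟨r, hr, hrU⟩ := Metric.isOpen_iff.1 hU c hcU
  -- The cube `[-1, 1]^d` lies within `√d` of the origin, and the shift by `c` adds `‖c‖`. The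
  -- summand 1 keeps the radius positive when `d = 0`.
  refine ⟨r, hr, √d + ‖c‖ + 1, by positivity, fun K hK hKc hint => ?_⟩
  obtain ⟨p, hp⟩ := hint
  let K₀ : Set (EuclideanSpace ℝ (Fin d)) := (fun x => x + p) ⁻¹' K
  have hK₀ : Convex ℝ K₀ := hK.translate_preimage_left p
  have hK₀c : IsCompact K₀ := (Homeomorph.addRight p).isCompact_preimage.2 hKc
  have h0 : (0 : EuclideanSpace ℝ (Fin d)) ∈ interior K₀ := by
    have : interior K₀ = (fun x => x + p) ⁻¹' interior K :=
      ((Homeomorph.addRight p).preimage_interior K).symm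
    rw [this]
    simpa using hp
  let e := (EuclideanSpace.basisFun (Fin d) ℝ).toBasis
  have hcont : Continuous fun v : Fin d → EuclideanSpace ℝ (Fin d) => |e.det v| := by
    simp only [Module.Basis.det_apply]
    refine (Continuous.matrix_det ?_).abs
    refine continuous_matrix fun i j => ?_
    simp only [Module.Basis.toMatrix_apply, e, OrthonormalBasis.coe_toBasis_repr_apply,
      EuclideanSpace.basisFun_repr]
    fun_prop
  -- The points `v i`, together with 0, span a simplex of maximal volume among those in `K₀` with a
  -- vertex at 0.
  obtain ⟨v, hv, hvmax⟩ := (isCompact_univ_pi fun _ : Fin d => hK₀c).exists_isMaxOn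
    ⟨fun _ => 0, fun _ _ => interior_subset h0⟩ hcont.continuousOn
  have hvK : ∀ i, v i ∈ K₀ := fun i => hv i (Set.mem_univ i)
  have hdet : e.det v ≠ 0 := by
    obtain ⟨ρ, hρ, hρK⟩ := Metric.mem_nhds_iff.1 (mem_interior_iff_mem_nhds.1 h0)
    have h1 := hvmax (show (fun i => (ρ / 2) • e i) ∈ Set.univ.pi fun _ => K₀ from
      fun i _ => hρK (by
        rw [mem_ball_zero_iff, norm_smul, Real.norm_of_nonneg (by linarith)]
        simp only [e, OrthonormalBasis.coe_toBasis, OrthonormalBasis.norm_eq_one]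
        linarith))
    have h2 : e.det (fun i => (ρ / 2) • e i) = (ρ / 2) ^ d := by
      have := e.det.map_smul_univ (fun _ => ρ / 2) e
      rw [this, e.det_self, Finset.prod_const, Finset.card_univ, Fintype.card_fin, smul_eq_mul,
        mul_one]
    intro h3
    simp only [Set.mem_ofPred_eq, h2, h3, abs_zero] at h1
    have : 0 < |(ρ / 2) ^ d| := abs_pos.2 (by positivity)
    linarith
  obtain ⟨hli, hsp⟩ := (Module.Basis.is_basis_iff_det e).2 (isUnit_iff_ne_zero.2 hdet)
  let B := Module.Basis.mk hli hsp.ge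
  -- Cramer's rule: replacing `v i` by `x` multiplies the determinant by the `i`-th coordinate of
  -- `x`, so maximality bounds that coordinate by 1.
  have hcoord : ∀ x ∈ K₀, ∀ i, |B.coord i x| ≤ 1 := by
    intro x hx i
    have h1 := congrArg (fun f : EuclideanSpace ℝ (Fin d) →ₗ[ℝ] ℝ => |f x|)
      (e.det_smul_mk_coord_eq_det_update hli hsp.ge i)
    have h2 : |e.det (Function.update v i x)| ≤ |e.det v| := by
      refine hvmax fun j _ => ?_
      by_cases hji : j = i
      · subst hji; simpa using hx
      · simpa [Function.update_of_ne hji] using hvK j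
    have h3 : |e.det v| * |B.coord i x| = |e.det (Function.update v i x)| := by
      rw [← abs_mul]
      exact h1
    have h4 : 0 < |e.det v| := abs_pos.2 hdet
    rw [← h3] at h2
    exact le_of_mul_le_mul_left (by linarith) h4
  let T : EuclideanSpace ℝ (Fin d) ≃L[ℝ] EuclideanSpace ℝ (Fin d) :=
    (B.equivFun.trans (WithLp.linearEquiv 2 ℝ (Fin d → ℝ)).symm).toContinuousLinearEquiv
  have hT : ∀ x i, T x i = B.coord i x := fun x i => rfl
  have hTB : ∀ x, x = ∑ i, T x i • v i := fun x => by
    conv_lhs => rw [← B.sum_repr x]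
    refine Finset.sum_congr rfl fun i _ => ?_
    rw [hT, Module.Basis.mk_apply]
    rfl
  have hφ : ∀ x, T x + (-T p - c) = T (x - p) - c := fun x => by rw [map_sub]; abel
  refine ⟨T, -T p - c, fun x hx => ?_, ?_⟩
  · have hxU : x + c ∈ U := hrU (by rw [Metric.mem_ball, dist_eq_norm]; simpa using hx)
    have hmem : T.symm (x + c) ∈ K₀ := by
      rw [hTB (T.symm (x + c))]
      simp only [ContinuousLinearEquiv.apply_symm_apply]
      -- A convex combination of 0 and the `v i`; `none` indexes the vertex 0 and carries the
      -- remaining weight.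
      have := hK₀.sum_mem (t := Finset.univ) (R := ℝ)
        (w := fun o : Option (Fin d) => o.elim (1 - ∑ i, (x + c) i) fun i => (x + c) i)
        (z := fun o : Option (Fin d) => o.elim 0 v)
        (by
          rintro (_ | i) -
          · have := hxU.2
            simp only [Option.elim]
            linarith
          · exact (hxU.1 i).le)
        (by simp [Fintype.sum_option])
        (by
          rintro (_ | i) -
          · exact interior_subset h0
          · exact hvK i)
      simpa [Fintype.sum_option] using this
    refine ⟨T.symm (x + c) + p, hmem, ?_⟩
    simp only [hφ, add_sub_cancel_right, ContinuousLinearEquiv.apply_symm_apply]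
  · rintro _ ⟨x, hx, rfl⟩
    simp only [hφ]
    have hx' : x - p ∈ K₀ := by simpa [K₀] using hx
    have h1 : ‖T (x - p)‖ ≤ √d := by
      rw [EuclideanSpace.norm_eq]
      refine Real.sqrt_le_sqrt ?_
      calc ∑ i, ‖T (x - p) i‖ ^ 2 ≤ ∑ _i : Fin d, (1 : ℝ) :=
            Finset.sum_le_sum fun i _ => by
              rw [hT]
              exact pow_le_one₀ (norm_nonneg _) (hcoord _ hx' i)
        _ = d := by simp
    have h2 := norm_sub_le (T (x - p)) c
    rw [mem_closedBall_zero_iff]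
    linarith

end Normalization

theorem IsClosedHalfSpace.preimage_affine {E : Type*} [NormedAddCommGroup E]
    [InnerProductSpace ℝ E] [CompleteSpace E] {H : Set E} (hH : IsClosedHalfSpace H)
    (T : E ≃L[ℝ] E) (w : E) : IsClosedHalfSpace ((fun x => T x + w) ⁻¹' H) := by
  obtain ⟨a, b, ha, rfl⟩ := hH
  refine ⟨ContinuousLinearMap.adjoint (T : E →L[ℝ] E) a, b - inner ℝ a w, fun h => ha ?_, ?_⟩
  · have h1 : inner ℝ (ContinuousLinearMap.adjoint (T : E →L[ℝ] E) a) (T.symm a) = 0 := by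
      rw [h, inner_zero_left]
    rw [ContinuousLinearMap.adjoint_inner_left] at h1
    simpa using h1
  · ext x
    simp only [Set.mem_preimage, Set.mem_ofPred_eq, inner_add_right,
      ContinuousLinearMap.adjoint_inner_left, ContinuousLinearEquiv.coe_coe]
    constructor <;> intro h <;> linarith

/-- Volume ratios and half-space counts are invariant under affine bijections, and closing a convex
set does not change its volume. So the bound for bodies between two fixed balls applies to every
`K`. -/
theorem circumscribedFacetNumbers_nonempty (d : ℕ) {ε : ℝ} (hε : 0 < ε) :
    (circumscribedFacetNumbers d ε).Nonempty := by
  classical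
  obtain ⟨r, hr, R, hR, hnorm⟩ := exists_affine_normalization d
  obtain ⟨n, hn⟩ := exists_card_circumscribed_of_ball_subset
    (volume : Measure (EuclideanSpace ℝ (Fin d))) hr hR hε
  refine ⟨n, mem_circumscribedFacetNumbers_iff.2 fun K hK hpos hfin => ?_⟩
  have hint := hK.nonempty_interior_of_measure_pos volume hpos
  have hcomp : IsCompact (closure K) :=
    (hK.isBounded_of_measure_lt_top volume hint hfin).isCompact_closure
  obtain ⟨T, w, hball, hbdd⟩ :=
    hnorm (closure K) hK.closure hcomp (hint.mono (interior_mono subset_closure))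
  set φ : EuclideanSpace ℝ (Fin d) → EuclideanSpace ℝ (Fin d) := fun x => T x + w with hφ
  have hφinj : Function.Injective φ := fun x y h => T.injective (add_right_cancel h)
  obtain ⟨𝓗, h𝓗, hcard, hsub, hvol⟩ := hn (φ '' closure K)
    (by
      have : φ '' closure K = (fun x => w + x) '' ((T : _ →L[ℝ] _) '' closure K) := by
        rw [Set.image_image]
        simp only [hφ, ContinuousLinearEquiv.coe_coe, add_comm]
      rw [this]
      exact (hK.closure.is_linear_image
        (T : EuclideanSpace ℝ (Fin d) →L[ℝ] EuclideanSpace ℝ (Fin d)).isLinear).translate w)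
    (hcomp.image (by fun_prop)) hball hbdd
  have hmeas : ∀ S, volume (φ ⁻¹' S) =
      ENNReal.ofReal |LinearMap.det (T.symm : EuclideanSpace ℝ (Fin d) →ₗ[ℝ] _)| *
        volume S := by
    intro S
    have : φ ⁻¹' S = T ⁻¹' ((fun x => x + w) ⁻¹' S) := rfl
    rw [this, Measure.addHaar_preimage_continuousLinearEquiv volume T, measure_preimage_add_right]
  have hinter : ⋂ H ∈ 𝓗.image (fun H => φ ⁻¹' H), H = φ ⁻¹' ⋂ H ∈ 𝓗, H := by
    ext; simp
  refine ⟨𝓗.image (fun H => φ ⁻¹' H), ?_, Finset.card_image_le.trans hcard, ?_, ?_⟩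
  · intro H hH
    obtain ⟨G, hG, rfl⟩ := Finset.mem_image.1 hH
    exact (h𝓗 G hG).preimage_affine T w
  · rw [hinter]
    exact subset_closure.trans (Set.image_subset_iff.1 hsub)
  · have hKφ : volume K = volume (φ ⁻¹' (φ '' closure K)) := by
      rw [Set.preimage_image_eq _ hφinj, hK.measure_closure volume]
    rw [hinter, hKφ, hmeas, hmeas, mul_left_comm]
    gcongr

/-! ### Consequences of Helly's theorem and the quantitative Helly property. -/

section Helly

/-- If a convex set is disjoint from the nonempty intersection of a finite family of convex sets,
then it is disjoint from the intersection of some `dim E` of them. -/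
theorem exists_card_le_finrank_disjoint {E : Type*} [AddCommGroup E] [Module ℝ E]
    [FiniteDimensional ℝ E] {𝓕 : Finset (Set E)} (h𝓕 : ∀ A ∈ 𝓕, Convex ℝ A)
    (hne : (⋂ A ∈ 𝓕, A).Nonempty) {C : Set E} (hC : Convex ℝ C)
    (hdisj : Disjoint (⋂ A ∈ 𝓕, A) C) :
    ∃ 𝓖 ⊆ 𝓕, 𝓖.card ≤ Module.finrank ℝ E ∧ Disjoint (⋂ A ∈ 𝓖, A) C := by
  classical
  by_contra! h
  have h' : ∀ 𝓖 ⊆ 𝓕, 𝓖.card ≤ Module.finrank ℝ E → ((⋂ A ∈ 𝓖, A) ∩ C).Nonempty :=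
    fun 𝓖 h1 h2 => Set.not_disjoint_iff_nonempty_inter.1 (h 𝓖 h1 h2)
  -- Among `dim E + 1` sets including `C`, at most `dim E` others occur. Subfamilies avoiding `C`
  -- meet because the whole family does.
  have := Convex.helly_theorem' (𝕜 := ℝ) (F := fun A : Set E => A) (s := insert C 𝓕)
    (by simpa using ⟨hC, h𝓕⟩) (by
      intro I hI hcard
      by_cases hCI : C ∈ I
      · refine (h' (I.erase C) ?_ ?_).mono ?_
        · intro A hA
          obtain ⟨hAC, hAI⟩ := Finset.mem_erase.1 hA
          exact Finset.mem_of_mem_insert_of_ne (hI hAI) hAC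
        · rw [Finset.card_erase_of_mem hCI]
          omega
        · rintro x ⟨hx, hxC⟩
          simp only [Set.mem_iInter] at hx ⊢
          intro A hA
          by_cases hAC : A = C
          · rwa [hAC]
          · exact hx A (Finset.mem_erase.2 ⟨hAC, hA⟩)
      · refine hne.mono (Set.biInter_subset_biInter_left fun A hA => ?_)
        have := hI hA
        rcases Finset.mem_insert.1 this with rfl | h
        · exact absurd hA hCI
        · exact h)
  obtain ⟨x, hx⟩ := this
  simp only [Set.mem_iInter, Finset.mem_insert, forall_eq_or_imp] at hx
  exact Set.disjoint_left.1 hdisj (by simpa using hx.2) hx.1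

/-- If the intersections of at most `dim E + 1` members of a finite family of convex sets have
positive measure, then so does the intersection of the whole family. -/
theorem measure_biInter_pos_of_helly {E : Type*} [NormedAddCommGroup E] [NormedSpace ℝ E]
    [FiniteDimensional ℝ E] [MeasurableSpace E] [BorelSpace E] (μ : Measure E)
    [μ.IsAddHaarMeasure] {𝓕 : Finset (Set E)} (h𝓕 : ∀ A ∈ 𝓕, Convex ℝ A)
    (hpos : ∀ 𝓖 ⊆ 𝓕, 𝓖.card ≤ Module.finrank ℝ E + 1 → 0 < μ (⋂ A ∈ 𝓖, A)) :
    0 < μ (⋂ A ∈ 𝓕, A) := by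
  have hint : ∀ 𝓖 : Finset (Set E), interior (⋂ A ∈ 𝓖, A) = ⋂ A ∈ 𝓖, interior A := fun 𝓖 => by
    have := Finset.interior_iInter 𝓖 (fun A : Set E => A)
    exact this
  -- Helly's theorem is applied to the interiors, since finite intersections commute with
  -- `interior`.
  have hne : (⋂ A ∈ 𝓕, interior A).Nonempty := by
    refine Convex.helly_theorem' (𝕜 := ℝ) (fun A hA => (h𝓕 A hA).interior) fun 𝓖 h𝓖 hcard => ?_
    rw [← hint]
    exact (convex_iInter₂ fun A hA => h𝓕 A (h𝓖 hA)).nonempty_interior_of_measure_pos μ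
      (hpos 𝓖 h𝓖 hcard)
  rw [← hint] at hne
  exact (isOpen_interior.measure_pos μ hne).trans_le (measure_mono interior_subset)

end Helly

/-- A bounded intersection of half-spaces in a nontrivial space involves at least two of them. -/
theorem two_le_card_of_isBounded {E : Type*} [NormedAddCommGroup E] [InnerProductSpace ℝ E]
    [Nontrivial E] {𝓗 : Finset (Set E)} (h𝓗 : ∀ H ∈ 𝓗, IsClosedHalfSpace H)
    (hbdd : Bornology.IsBounded (⋂ H ∈ 𝓗, H)) : 2 ≤ 𝓗.card := by
  by_contra! hcard
  obtain ⟨a, ha, b, hab⟩ : ∃ a : E, a ≠ 0 ∧ ∃ b : ℝ, {x | inner ℝ a x ≤ b} ⊆ ⋂ H ∈ 𝓗, H := by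
    rcases 𝓗.eq_empty_or_nonempty with rfl | hne
    · obtain ⟨a, ha⟩ := exists_ne (0 : E)
      exact ⟨a, ha, 0, by simp⟩
    · obtain ⟨H, rfl⟩ := Finset.card_eq_one.1
        (show 𝓗.card = 1 by have := hne.card_pos; omega)
      obtain ⟨a, b, ha, rfl⟩ := h𝓗 H (by simp)
      exact ⟨a, ha, b, by simp⟩
  obtain ⟨R, hR⟩ := (hbdd.subset hab).exists_norm_le
  have hna : 0 < ‖a‖ := norm_pos_iff.2 ha
  -- The first summand puts `-(t • a)` in the half-space, the second makes its norm exceed `R`.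
  set t : ℝ := |b| / ‖a‖ ^ 2 + (|R| + 1) / ‖a‖ with ht
  have ht0 : 0 ≤ t := by positivity
  have h1 : t * ‖a‖ ^ 2 ≥ |b| := by
    rw [ht, add_mul, div_mul_cancel₀ _ (by positivity)]
    have : 0 ≤ (|R| + 1) / ‖a‖ * ‖a‖ ^ 2 := by positivity
    linarith
  have h2 : t * ‖a‖ ≥ |R| + 1 := by
    rw [ht, add_mul, div_mul_cancel₀ _ hna.ne']
    have : 0 ≤ |b| / ‖a‖ ^ 2 * ‖a‖ := by positivity
    linarith
  have h3 := hR (-(t • a)) (by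
    change inner ℝ a (-(t • a)) ≤ b
    rw [inner_neg_right, real_inner_smul_right, real_inner_self_eq_norm_sq]
    have := neg_abs_le b
    linarith)
  rw [norm_neg, norm_smul, Real.norm_of_nonneg ht0] at h3
  have := le_abs_self R
  linarith

/-- This supplies `d + 1 ≤ n * d` for Helly's theorem, and ensures that `n - 1` is not a truncated
subtraction. -/
theorem two_le_of_mem_circumscribedFacetNumbers {d n : ℕ} (hd : 0 < d) {ε : ℝ}
    (hn : n ∈ circumscribedFacetNumbers d ε) : 2 ≤ n := by
  have : Nonempty (Fin d) := ⟨⟨0, hd⟩⟩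
  have hpos : 0 < volume (Metric.ball (0 : EuclideanSpace ℝ (Fin d)) 1) :=
    Metric.measure_ball_pos volume 0 one_pos
  obtain ⟨𝓗, h𝓗, hcard, hsub, hvol⟩ := mem_circumscribedFacetNumbers_iff.1 hn
    (Metric.ball 0 1) (convex_ball 0 1) hpos measure_ball_lt_top
  refine (two_le_card_of_isBounded h𝓗 ?_).trans hcard
  refine (convex_biInter_halfSpaces h𝓗).isBounded_of_measure_lt_top volume
    (((convex_ball _ _).nonempty_interior_of_measure_pos volume hpos).mono (interior_mono hsub))
    (hvol.trans_lt (ENNReal.mul_lt_top ENNReal.ofReal_lt_top measure_ball_lt_top))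

/-- The quantitative Helly property for volume. -/
theorem le_volume_biInter_of_mem_circumscribedFacetNumbers {d n : ℕ} (hd : 0 < d) {ε : ℝ}
    (hε : 0 < ε) (hn : n ∈ circumscribedFacetNumbers d ε)
    {𝓕 : Finset (Set (EuclideanSpace ℝ (Fin d)))} (h𝓕 : ∀ A ∈ 𝓕, Convex ℝ A)
    (hvol : ∀ 𝓖 ⊆ 𝓕, 𝓖.card ≤ n * d → 1 ≤ volume (⋂ A ∈ 𝓖, A)) :
    ENNReal.ofReal ((1 + ε)⁻¹) ≤ volume (⋂ A ∈ 𝓕, A) := by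
  classical
  have hn2 := two_le_of_mem_circumscribedFacetNumbers hd hn
  have hpos : 0 < volume (⋂ A ∈ 𝓕, A) := by
    refine measure_biInter_pos_of_helly volume h𝓕 fun 𝓖 h𝓖 hcard => ?_
    rw [finrank_euclideanSpace_fin] at hcard
    exact one_pos.trans_le (hvol 𝓖 h𝓖 (hcard.trans (by nlinarith)))
  rcases eq_or_ne (volume (⋂ A ∈ 𝓕, A)) ⊤ with htop | htop
  · rw [htop]
    exact le_top
  obtain ⟨𝓗, h𝓗, hcard, hsub, hle⟩ := mem_circumscribedFacetNumbers_iff.1 hn _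
    (convex_iInter₂ h𝓕) hpos htop.lt_top
  have hex : ∀ H ∈ 𝓗, ∃ 𝓖 ⊆ 𝓕, 𝓖.card ≤ d ∧ ⋂ A ∈ 𝓖, A ⊆ H := by
    intro H hH
    obtain ⟨𝓖, h1, h2, h3⟩ := exists_card_le_finrank_disjoint h𝓕
      (nonempty_of_measure_ne_zero hpos.ne') (h𝓗 H hH).convex_compl
      (Set.disjoint_compl_right_iff_subset.2 (hsub.trans (Set.biInter_subset_of_mem hH)))
    rw [finrank_euclideanSpace_fin] at h2
    exact ⟨𝓖, h1, h2, Set.disjoint_compl_right_iff_subset.1 h3⟩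
  choose! g hg𝓕 hgcard hgsub using hex
  have h1 : 1 ≤ volume (⋂ A ∈ 𝓗.biUnion g, A) := by
    refine hvol _ (Finset.biUnion_subset.2 hg𝓕) ?_
    exact (Finset.card_biUnion_le_card_mul _ _ _ hgcard).trans (Nat.mul_le_mul_right d hcard)
  have h2 : ⋂ A ∈ 𝓗.biUnion g, A ⊆ ⋂ H ∈ 𝓗, H := by
    refine Set.subset_iInter₂ fun H hH => subset_trans ?_ (hgsub H hH)
    exact Set.biInter_subset_biInter_left fun A hA => Finset.mem_biUnion.2 ⟨H, hH, hA⟩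
  have h3 := h1.trans ((measure_mono h2).trans hle)
  rw [ENNReal.ofReal_inv_of_pos (by linarith)]
  exact (ENNReal.inv_le_iff_le_mul (fun _ => by simp; linarith) (by simp)).2 h3

/-! ### Supporting half-spaces and lower semicontinuity of the volume they cut out. -/

section Support

variable {E : Type*} [NormedAddCommGroup E] [InnerProductSpace ℝ E]

/-- The support function of a set. -/
noncomputable def supportFn (C : Set E) (u : E) : ℝ :=
  sSup ((fun x => inner ℝ u x) '' C)

theorem continuous_supportFn {C : Set E} (hC : IsCompact C) : Continuous (supportFn C) :=
  hC.continuous_sSup (f := fun u x : E => inner ℝ u x) (by fun_prop)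

theorem inner_le_supportFn {C : Set E} (hC : IsCompact C) {x : E} (hx : x ∈ C) (u : E) :
    inner ℝ u x ≤ supportFn C u :=
  le_csSup (hC.image (by fun_prop)).bddAbove ⟨x, hx, rfl⟩

theorem supportFn_le {C : Set E} (hne : C.Nonempty) {u : E} {b : ℝ}
    (h : ∀ x ∈ C, inner ℝ u x ≤ b) : supportFn C u ≤ b :=
  csSup_le (hne.image _) (by rintro _ ⟨x, hx, rfl⟩; exact h x hx)

/-- A half-space containing a nonempty set contains one of its supporting half-spaces. -/
theorem IsClosedHalfSpace.exists_supporting_subset {C H : Set E} (hH : IsClosedHalfSpace H)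
    (hne : C.Nonempty) (hCH : C ⊆ H) :
    ∃ u ∈ Metric.sphere (0 : E) 1, {x | inner ℝ u x ≤ supportFn C u} ⊆ H := by
  obtain ⟨a, b, ha, rfl⟩ := hH
  have hpos : 0 < ‖a‖⁻¹ := inv_pos.2 (norm_pos_iff.2 ha)
  refine ⟨‖a‖⁻¹ • a, by simpa using norm_smul_inv_norm (𝕜 := ℝ) ha, fun x hx => ?_⟩
  have h1 : supportFn C (‖a‖⁻¹ • a) ≤ ‖a‖⁻¹ * b := by
    refine supportFn_le hne fun y hy => ?_
    rw [real_inner_smul_left]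
    exact mul_le_mul_of_nonneg_left (hCH hy) hpos.le
  have h2 := le_trans hx h1
  rw [real_inner_smul_left] at h2
  exact le_of_mul_le_mul_left h2 hpos

variable [FiniteDimensional ℝ E] [MeasurableSpace E] [BorelSpace E] (μ : Measure E)
  [μ.IsAddHaarMeasure]

/-- The measure of an intersection of supporting half-spaces depends lower semicontinuously on
their normals. -/
theorem lowerSemicontinuous_measure_supporting {C : Set E} (hC : IsCompact C) (m : ℕ) :
    LowerSemicontinuous fun u : Fin m → Metric.sphere (0 : E) 1 =>
      μ (⋂ i, {x | inner ℝ (u i : E) x ≤ supportFn C (u i)}) := by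
  have hh := continuous_supportFn hC
  -- Strict inequalities make `W` open. Its sections have the same measure as the closed polyhedra,
  -- since convex sets have null frontier.
  let W : Set ((Fin m → Metric.sphere (0 : E) 1) × E) :=
    {p | ∀ i, inner ℝ (p.1 i : E) p.2 < supportFn C (p.1 i)}
  have hW : IsOpen W := by
    have : W = ⋂ i, {p | inner ℝ (p.1 i : E) p.2 < supportFn C (p.1 i)} := by ext; simp [W]
    rw [this]
    refine isOpen_iInter_of_finite fun i => isOpen_lt ?_ ?_
    · fun_prop
    · exact hh.comp (by fun_prop)
  have hsub : ∀ u, {x | (u, x) ∈ W} ⊆ ⋂ i, {x | inner ℝ (u i : E) x ≤ supportFn C (u i)} :=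
    fun u x hx => Set.mem_iInter.2 fun i => (hx i).le
  have hVle : ∀ u : Fin m → Metric.sphere (0 : E) 1,
      μ (⋂ i, {x | inner ℝ (u i : E) x ≤ supportFn C (u i)}) ≤ μ {x | (u, x) ∈ W} := by
    intro u
    set Q := ⋂ i, {x | inner ℝ (u i : E) x ≤ supportFn C (u i)} with hQ
    have hQc : Convex ℝ Q :=
      convex_iInter fun i => convex_halfSpace_le (innerSL ℝ (u i : E)).isLinear _
    have h1 : interior Q ⊆ {x | (u, x) ∈ W} := fun x hx i =>
      inner_lt_of_mem_interior hx (ne_zero_of_mem_unit_sphere (u i)) fun y hy =>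
        Set.mem_iInter.1 hy i
    calc μ Q ≤ μ (interior Q ∪ frontier Q) := measure_mono (by
          rw [← closure_eq_interior_union_frontier]; exact subset_closure)
      _ ≤ μ (interior Q) + μ (frontier Q) := measure_union_le _ _
      _ = μ (interior Q) := by rw [hQc.addHaar_frontier μ, add_zero]
      _ ≤ _ := measure_mono h1
  intro u y hy
  -- Inner regularity gives a compact `L` in the section over `u` with measure above `y`; by the
  -- tube lemma `L` remains in the sections over all nearby `u'`.
  obtain ⟨L, hLW, hL, hyL⟩ :=
    (hW.preimage (Continuous.prodMk_right u)).exists_lt_isCompact (hy.trans_le (hVle u))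
  obtain ⟨N, O, hN, -, huN, hLO, hNO⟩ := generalized_tube_lemma (isCompact_singleton (x := u)) hL
    hW (by rintro ⟨u', x⟩ ⟨rfl, hx⟩; exact hLW hx)
  filter_upwards [hN.mem_nhds (huN rfl)] with u' hu'
  exact hyL.trans_le (measure_mono fun x hx => hsub u' (hNO ⟨hu', hLO hx⟩))

end Support

/-! ### The uniform gap and the extremal family. -/

/-- If `m` is not a circumscribed facet number, then this is witnessed by a convex set with a
uniform gap. -/
theorem exists_gap_of_notMem_circumscribedFacetNumbers {d m : ℕ} (hd : 0 < d) {ε : ℝ}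
    (hm : m ∉ circumscribedFacetNumbers d ε) :
    ∃ K : Set (EuclideanSpace ℝ (Fin d)), Convex ℝ K ∧ 0 < volume K ∧ volume K < ⊤ ∧
      ∃ c, ENNReal.ofReal (1 + ε) * volume K < c ∧
        ∀ 𝓖 : Finset (Set (EuclideanSpace ℝ (Fin d))), (∀ H ∈ 𝓖, IsClosedHalfSpace H) →
          (∀ H ∈ 𝓖, K ⊆ H) → 𝓖.card ≤ m → c ≤ volume (⋂ H ∈ 𝓖, H) := by
  classical
  rw [mem_circumscribedFacetNumbers_iff] at hm
  push Not at hm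
  obtain ⟨K, hK, hpos, hfin, hbad⟩ := hm
  refine ⟨K, hK, hpos, hfin, ?_⟩
  have : Nonempty (Fin d) := ⟨⟨0, hd⟩⟩
  set C := closure K
  have hC : IsCompact C := (hK.isBounded_of_measure_lt_top volume
    (hK.nonempty_interior_of_measure_pos volume hpos) hfin).isCompact_closure
  have hCne : C.Nonempty := (nonempty_of_measure_ne_zero hpos.ne').closure
  let S : Metric.sphere (0 : EuclideanSpace ℝ (Fin d)) 1 → Set (EuclideanSpace ℝ (Fin d)) :=
    fun u => {x | inner ℝ (u : EuclideanSpace ℝ (Fin d)) x ≤ supportFn C u}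
  have : Nonempty (Metric.sphere (0 : EuclideanSpace ℝ (Fin d)) 1) :=
    (NormedSpace.sphere_nonempty.2 zero_le_one).to_subtype
  -- The minimum over the compact product of spheres is itself realised by at most `m` half-spaces
  -- containing `K`, so it exceeds `(1 + ε) vol K` strictly.
  obtain ⟨u₀, -, hu₀⟩ := LowerSemicontinuousOn.exists_isMinOn (Set.univ_nonempty) isCompact_univ
    ((lowerSemicontinuous_measure_supporting volume hC m).lowerSemicontinuousOn Set.univ)
  refine ⟨volume (⋂ i, S (u₀ i)), ?_, fun 𝓖 h𝓖 hK𝓖 hcard => ?_⟩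
  · have hinter : ⋂ H ∈ Finset.univ.image (fun i => S (u₀ i)), H = ⋂ i, S (u₀ i) := by
      ext; simp
    rw [← hinter]
    refine hbad _ ?_ ?_ ?_
    · intro H hH
      obtain ⟨i, -, rfl⟩ := Finset.mem_image.1 hH
      exact ⟨u₀ i, _, ne_zero_of_mem_unit_sphere (u₀ i), rfl⟩
    · exact Finset.card_image_le.trans (by simp)
    · rw [hinter]
      exact Set.subset_iInter fun i x hx => inner_le_supportFn hC (subset_closure hx) _
  · have hex : ∀ H ∈ 𝓖, ∃ u, S u ⊆ H := fun H hH => by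
      obtain ⟨u, hu, huH⟩ := (h𝓖 H hH).exists_supporting_subset hCne
        (closure_minimal (hK𝓖 H hH) (h𝓖 H hH).isClosed)
      exact ⟨⟨u, hu⟩, huH⟩
    choose! ν hν using hex
    obtain ⟨e⟩ : Nonempty (𝓖 ↪ Fin m) :=
      Function.Embedding.nonempty_of_card_le (by simpa using hcard)
    -- Unused indices get an arbitrary normal, which can only shrink the intersection.
    let u : Fin m → Metric.sphere (0 : EuclideanSpace ℝ (Fin d)) 1 :=
      Function.extend e (fun H => ν H) fun _ => Classical.arbitrary _
    refine le_trans (hu₀ (Set.mem_univ u)) (measure_mono ?_)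
    refine Set.subset_iInter₂ fun H hH => ?_
    have hue : u (e ⟨H, hH⟩) = ν H := e.injective.extend_apply _ _ _
    exact (Set.iInter_subset (fun i => S (u i)) (e ⟨H, hH⟩)).trans (hue ▸ hν H hH)

/-- If `m` is not a circumscribed facet number, then subfamilies of size `m` do not suffice for
the quantitative Helly property. -/
theorem exists_family_of_notMem_circumscribedFacetNumbers {d m : ℕ} (hd : 0 < d) {ε : ℝ}
    (hε : 0 < ε) (hm : m ∉ circumscribedFacetNumbers d ε) :
    ∃ 𝓕 : Finset (Set (EuclideanSpace ℝ (Fin d))), (∀ A ∈ 𝓕, Convex ℝ A) ∧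
      (∀ 𝓖 ⊆ 𝓕, 𝓖.card ≤ m → 1 ≤ volume (⋂ A ∈ 𝓖, A)) ∧
      volume (⋂ A ∈ 𝓕, A) < ENNReal.ofReal ((1 + ε)⁻¹) := by
  classical
  obtain ⟨K, hK, hpos, hfin, c, hc, hgap⟩ :=
    exists_gap_of_notMem_circumscribedFacetNumbers hd hm
  obtain ⟨V, hV, hKV⟩ : ∃ V : ℝ, 0 < V ∧ volume K = ENNReal.ofReal V :=
    ⟨_, ENNReal.toReal_pos hpos.ne' hfin.ne, (ENNReal.ofReal_toReal hfin.ne).symm⟩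
  rw [hKV, ← ENNReal.ofReal_mul (by linarith)] at hc
  obtain ⟨w, hw0, hVw, hwc⟩ := ENNReal.lt_iff_exists_real_btwn.1 hc
  have hVw : (1 + ε) * V < w := (ENNReal.ofReal_lt_ofReal_iff_of_nonneg (by positivity)).1 hVw
  have hw : 0 < w := lt_trans (by positivity) hVw
  -- Half the relative excess of `w` over `(1 + ε) * V`, so that a `δ`-approximation of `K` still
  -- has volume below `w / (1 + ε)`.
  set δ : ℝ := (w / ((1 + ε) * V) - 1) / 2 with hδ
  have hq : 1 < w / ((1 + ε) * V) := (one_lt_div (by positivity)).2 hVw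
  have hδ0 : 0 < δ := by rw [hδ]; linarith
  have hδw : (1 + δ) * V < (1 + ε)⁻¹ * w := by
    have h1 : 1 + δ < w / ((1 + ε) * V) := by rw [hδ]; linarith
    rw [lt_div_iff₀ (by positivity)] at h1
    rw [inv_mul_eq_div, lt_div_iff₀ (by linarith)]
    linarith
  obtain ⟨k, hk⟩ := circumscribedFacetNumbers_nonempty d hδ0
  obtain ⟨𝓗, h𝓗, -, hsub, hle⟩ := mem_circumscribedFacetNumbers_iff.1 hk K hK hpos hfin
  have hK𝓗 : ∀ H ∈ 𝓗, K ⊆ H := fun H hH => hsub.trans (Set.biInter_subset_of_mem hH)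
  -- Scaling by `s` divides volumes by `w`: the `m`-fold intersections, of volume at least `c > w`,
  -- end above 1, and the total one below `(1 + ε)⁻¹`.
  set s : ℝ := w⁻¹ ^ ((d : ℝ)⁻¹) with hs
  have hs0 : 0 < s := by positivity
  have hsd : s ^ d = w⁻¹ := Real.rpow_inv_natCast_pow (by positivity) hd.ne'
  have hinter : ∀ 𝓖 : Finset (Set (EuclideanSpace ℝ (Fin d))),
      volume (⋂ A ∈ 𝓖.image (fun H => s • H), A) =
        ENNReal.ofReal w⁻¹ * volume (⋂ H ∈ 𝓖, H) := by
    intro 𝓖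
    have : ⋂ A ∈ 𝓖.image (fun H => s • H), A = s • ⋂ H ∈ 𝓖, H := by
      ext x
      simp [Set.mem_smul_set_iff_inv_smul_mem₀ hs0.ne']
    rw [this, Measure.addHaar_smul_of_nonneg volume hs0.le, finrank_euclideanSpace_fin, hsd]
  refine ⟨𝓗.image fun H => s • H, ?_, ?_, ?_⟩
  · intro A hA
    obtain ⟨H, hH, rfl⟩ := Finset.mem_image.1 hA
    exact (h𝓗 H hH).convex.smul s
  · intro 𝓖 h𝓖 hcard
    obtain ⟨𝓖', h𝓖', rfl⟩ := Finset.subset_image_iff.1 h𝓖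
    rw [Finset.card_image_of_injective _ (MulAction.injective₀ hs0.ne')] at hcard
    have h𝓖' : 𝓖' ⊆ 𝓗 := by exact_mod_cast h𝓖'
    have h1 := hgap 𝓖' (fun H hH => h𝓗 H (h𝓖' hH)) (fun H hH => hK𝓗 H (h𝓖' hH)) hcard
    rw [hinter]
    calc (1 : ENNReal) = ENNReal.ofReal w⁻¹ * ENNReal.ofReal w := by
          rw [← ENNReal.ofReal_mul (by positivity), inv_mul_cancel₀ hw.ne', ENNReal.ofReal_one]
      _ ≤ _ := by gcongr; exact hwc.le.trans h1
  · rw [hinter]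
    calc ENNReal.ofReal w⁻¹ * volume (⋂ H ∈ 𝓗, H)
        ≤ ENNReal.ofReal w⁻¹ * (ENNReal.ofReal (1 + δ) * ENNReal.ofReal V) := by
          rw [hKV] at hle
          gcongr
      _ = ENNReal.ofReal (w⁻¹ * ((1 + δ) * V)) := by
          rw [← ENNReal.ofReal_mul (by linarith), ← ENNReal.ofReal_mul (by positivity)]
      _ < _ := by
          refine (ENNReal.ofReal_lt_ofReal_iff (by positivity)).2 ?_
          rw [inv_mul_eq_div, div_lt_iff₀ hw]
          exact hδw

theorem theorem3p1 (d : ℕ) (hd : 0 < d) (ε : ℝ) (hε : 0 < ε) :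
    -- the number `n^*(d, ε)` exists
    IsLeast (circumscribedFacetNumbers d ε) (nStar d ε) ∧
    -- the quantitative Helly property
    (∀ 𝓕 : Finset (Set (EuclideanSpace ℝ (Fin d))), (∀ A ∈ 𝓕, Convex ℝ A) →
      (∀ 𝓖 ⊆ 𝓕, 𝓖.card ≤ nStar d ε * d → 1 ≤ volume (⋂ A ∈ 𝓖, A)) →
      ENNReal.ofReal ((1 + ε)⁻¹) ≤ volume (⋂ A ∈ 𝓕, A)) ∧
    -- subfamilies of size `n^*(d, ε) - 1` do not suffice
    (∃ 𝓕 : Finset (Set (EuclideanSpace ℝ (Fin d))), (∀ A ∈ 𝓕, Convex ℝ A) ∧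
      (∀ 𝓖 ⊆ 𝓕, 𝓖.card ≤ nStar d ε - 1 → 1 ≤ volume (⋂ A ∈ 𝓖, A)) ∧
      volume (⋂ A ∈ 𝓕, A) < ENNReal.ofReal ((1 + ε)⁻¹)) := by
  -- Nonemptiness is essential: `sInf ∅` would be the default value 0.
  have hmem : nStar d ε ∈ circumscribedFacetNumbers d ε :=
    Nat.sInf_mem (circumscribedFacetNumbers_nonempty d hε)
  have h2 := two_le_of_mem_circumscribedFacetNumbers hd hmem
  refine ⟨⟨hmem, fun n hn => Nat.sInf_le hn⟩, fun 𝓕 h𝓕 hvol =>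
    le_volume_biInter_of_mem_circumscribedFacetNumbers hd hε hmem h𝓕 hvol, ?_⟩
  refine exists_family_of_notMem_circumscribedFacetNumbers hd hε fun h => ?_
  -- Contradictory only because `nStar d ε` is nonzero, which `h2` guarantees.
  have : nStar d ε ≤ nStar d ε - 1 := Nat.sInf_le h
  omega
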